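/- Let $\mu$ be a nontrivial probability measure (i.e. a probability measure with infinite support) on the unit circle $\mathbb{T}$. Let $\phi_n$, $n\ge 0$, be its monic orthogonal polynomials: $\phi_n$ is monic of degree $n$ and $\int_{\mathbb{T}} \bar z^{\,j}\phi_n(z)\,d\mu(z)=0$ for $0\le j\le n-1$. Let $\alpha_n=-\overline{\phi_{n+1}(0)}$, $n\ge 0$, be its Verblunsky coefficients. Put $\tau_0=1$ and $\tau_n=\tau_{n-1}\dfrac{1-\overline{\tau_{n-1}\alpha_{n-1}}}{1-\tau_{n-1}\alpha_{n-1}}$ for $n\ge 1$. A sequence $\{d_n\}_{n\ge1}$ is a positive chain sequence if $d_n=(1-g_{n-1})g_n$ for all $n\ge 1$, for some parameter sequence $\{g_n\}_{n\ge 0}$ with $0\le g_0<1$ and $0<g_n<1$ for $n\ge 1$. Its minimal parameter sequence is the (unique) parameter sequence with initial value $0$. The measure $\mu$ is said to be associated with the pair of real sequences $\{c_n\}_{n\ge1}$, $\{d_n\}_{n\ge1}$ if, for all $n\ge1$, $$c_n=\frac{-\operatorname{Im}(\tau_{n-1}\alpha_{n-1})}{1-\operatorname{Re}(\tau_{n-1}\alpha_{n-1})},\qquad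 d_n=(1-g_{n-1})g_n,\qquad\text{where } g_0=0,\quad g_n=\frac12\,\frac{|1-\tau_{n-1}\alpha_{n-1}|^2}{1-\operatorname{Re}(\tau_{n-1}\alpha_{n-1})}.$$ **Theorem.** Let $\{c_n\}_{n\ge1}$ be a real sequence, let $\{d_n\}_{n\ge1}$ be a positive chain sequence with minimal parameter sequence $\{m_n\}_{n\ge0}$, and put $b_n=1-2m_n$, $n\ge1$. Let $\mu$ be the nontrivial probability measure on $\mathbb{T}$ associated with $\{c_n\}_{n\ge1}$, $\{d_n\}_{n\ge1}$, and let $p\ge1$ be an integer. Then the Verblunsky coefficients of $\mu$ are $p$-periodic, that is $\alpha_{n+p}=\alpha_n$ for all $n\ge0$, if and only if the following two conditions hold for every $n\ge0$: 1. if $(b_{n+1},c_{n+1})\ne(0,0)$, then there is $k_n\in\mathbb{Z}$ with $$\sum_{j=n+1}^{n+p}\arg\left(\frac{1+ic_j}{1-ic_j}\right)=\arg\left(\frac{b_{n+1}-ic_{n+1}}{1-ic_{n+1}}\right)-\arg\left(\frac{b_{n+p+1}-ic_{n+p+1}}{1-ic_{n+p+1}}\right)+2k_n\pi;$$ 2.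 $$\frac{b_{n+1}^2+c_{n+1}^2}{1+c_{n+1}^2}=\frac{b_{n+p+1}^2+c_{n+p+1}^2}{1+c_{n+p+1}^2}.$$ Here $\arg$ is the principal argument with values in $(-\pi,\pi]$. If $(b_{n+1},c_{n+1})\neq(0,0)$, condition 2 guarantees that both arguments on the right-hand side of condition 1 are arguments of nonzero numbers; if $b_{n+1}=c_{n+1}=0$, nothing is required in condition 1 for that $n$. -/

import Mathlib

open MeasureTheory Polynomial
open scoped ComplexConjugate

/-! ### Nontrivial probability measures on the unit circle and their Verblunsky coefficients -/

/-- The unit circle carries its Borel σ-algebra. -/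
noncomputable instance Circle.instMeasurableSpaceBorel : MeasurableSpace Circle := borel Circle

instance Circle.instBorelSpaceBorel : BorelSpace Circle := ⟨rfl⟩

/-- A measure on the unit circle is nontrivial if it has infinite support. -/
def IsNontrivialMeasure (μ : Measure Circle) : Prop := μ.support.Infinite

/-- `P` is a monic polynomial of degree `n` with `∫ z̄ʲ P(z) dμ(z) = 0` for `0 ≤ j ≤ n - 1`. -/
def IsMonicOPUC (μ : Measure Circle) (n : ℕ) (P : ℂ[X]) : Prop :=
  P.Monic ∧ P.natDegree = n ∧ ∀ j < n, ∫ z : Circle, conj (z : ℂ) ^ j * P.eval (z : ℂ) ∂μ = 0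

/-- The monic orthogonal polynomial `φₙ` of `μ`. For a nontrivial probability measure it is the
one and only `P` with `IsMonicOPUC μ n P`, see `IsNontrivialMeasure.existsUnique_isMonicOPUC`. -/
noncomputable def monicOPUC (μ : Measure Circle) (n : ℕ) : ℂ[X] :=
  Classical.epsilon (IsMonicOPUC μ n)

/-- The Verblunsky coefficients `αₙ = - conj (φₙ₊₁(0))`, `n ≥ 0`. -/
noncomputable def verblunsky (μ : Measure Circle) (n : ℕ) : ℂ :=
  -conj ((monicOPUC μ (n + 1)).eval 0)

/-! ### Positive chain sequences -/

/-- `g = (gₙ)_{n ≥ 0}` is a parameter sequence of `d = (dₙ)_{n ≥ 1}` (the value `d 0` is not used):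
`dₙ = (1 - gₙ₋₁) gₙ` for `n ≥ 1`, with `0 ≤ g₀ < 1` and `0 < gₙ < 1` for `n ≥ 1`. -/
def IsParameterSequence (d g : ℕ → ℝ) : Prop :=
  (0 ≤ g 0 ∧ g 0 < 1) ∧ (∀ n, 0 < g (n + 1) ∧ g (n + 1) < 1) ∧
    ∀ n, d (n + 1) = (1 - g n) * g (n + 1)

/-- `d = (dₙ)_{n ≥ 1}` is a positive chain sequence. -/
def IsPositiveChainSequence (d : ℕ → ℝ) : Prop := ∃ g, IsParameterSequence d g

/-- `m` is the minimal parameter sequence of `d`: the parameter sequence with `m₀ = 0`. It exists,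
is unique and is the pointwise smallest one, see `IsPositiveChainSequence.existsUnique_minimal` and
`IsMinimalParameterSequence.le`. -/
def IsMinimalParameterSequence (d m : ℕ → ℝ) : Prop := IsParameterSequence d m ∧ m 0 = 0

/-! ### The pair of real sequences associated with a measure -/

/-- `τ₀ = 1`, `τₙ₊₁ = τₙ (1 - conj (τₙ αₙ)) / (1 - τₙ αₙ)`. -/
noncomputable def tauSeq (μ : Measure Circle) : ℕ → ℂ
  | 0 => 1
  | n + 1 => tauSeq μ n *
      ((1 - conj (tauSeq μ n) * conj (verblunsky μ n)) / (1 - tauSeq μ n * verblunsky μ n))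

/-- `cₙ = - Im (τₙ₋₁ αₙ₋₁) / (1 - Re (τₙ₋₁ αₙ₋₁))`, `n ≥ 1` (the value at `0` is a dummy). -/
noncomputable def cSeq (μ : Measure Circle) : ℕ → ℝ
  | 0 => 0
  | n + 1 => -(tauSeq μ n * verblunsky μ n).im / (1 - (tauSeq μ n * verblunsky μ n).re)

/-- `m₀ = 0` and `mₙ = ½ |1 - τₙ₋₁ αₙ₋₁|² / (1 - Re (τₙ₋₁ αₙ₋₁))`, `n ≥ 1`. -/
noncomputable def mSeq (μ : Measure Circle) : ℕ → ℝ
  | 0 => 0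
  | n + 1 => 1 / 2 * (‖1 - tauSeq μ n * verblunsky μ n‖ ^ 2 /
      (1 - (tauSeq μ n * verblunsky μ n).re))

/-- `μ` is the measure associated with the pair `{(cₙ)_{n ≥ 1}, (dₙ)_{n ≥ 1}}`: `μ` is a nontrivial
probability measure on the unit circle whose pair of sequences is `cₙ` (as above) and
`dₙ = (1 - mₙ₋₁) mₙ`. -/
structure IsAssociatedMeasure (μ : Measure Circle) (c d : ℕ → ℝ) : Prop where
  isProbabilityMeasure : IsProbabilityMeasure μ
  isNontrivial : IsNontrivialMeasure μ
  c_eq : ∀ n, c (n + 1) = cSeq μ (n + 1)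
  d_eq : ∀ n, d (n + 1) = (1 - mSeq μ n) * mSeq μ (n + 1)

/-! ### The definitions above are meaningful -/

theorem continuous_circle_coe : Continuous fun z : Circle => (z : ℂ) := by
  fun_prop

theorem Circle.integrable_of_continuous (μ : Measure Circle) [IsProbabilityMeasure μ] {f : Circle → ℂ}
    (hf : Continuous f) : Integrable f μ :=
  hf.integrable_of_hasCompactSupport (HasCompactSupport.of_compactSpace f)

/-- Nondegeneracy of the moment functional of a nontrivial measure. -/
theorem IsNontrivialMeasure.eq_zero_of_orthogonal {μ : Measure Circle} [IsProbabilityMeasure μ]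
    (hμ : IsNontrivialMeasure μ) {n : ℕ} {Q : ℂ[X]} (hQ : Q ∈ degreeLT ℂ n)
    (h : ∀ j < n, ∫ z : Circle, conj (z : ℂ) ^ j * Q.eval (z : ℂ) ∂μ = 0) : Q = 0 := by
  have hc : Continuous fun z : Circle => Q.eval (z : ℂ) :=
    Q.continuous.comp continuous_circle_coe
  have h1 : ∫ z : Circle, conj (Q.eval (z : ℂ)) * Q.eval (z : ℂ) ∂μ = 0 := by
    have e : ∀ z : Circle, conj (Q.eval (z : ℂ)) * Q.eval (z : ℂ) =
        ∑ j ∈ Finset.range n, conj (Q.coeff j) * (conj (z : ℂ) ^ j * Q.eval (z : ℂ)) := by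
      intro z
      have : Q.eval (z : ℂ) = ∑ j ∈ Finset.range n, Q.coeff j * (z : ℂ) ^ j := by
        rcases eq_or_ne Q 0 with rfl | h0
        · simp
        · exact eval_eq_sum_range' ((natDegree_lt_iff_degree_lt h0).2 (mem_degreeLT.1 hQ)) _
      conv_lhs => rw [show conj (Q.eval (z : ℂ)) = _ from congrArg _ this]
      simp only [map_sum, map_mul, map_pow, Finset.sum_mul, mul_assoc]
    simp_rw [e]
    rw [integral_finsetSum]
    · refine Finset.sum_eq_zero fun j hj => ?_
      rw [integral_const_mul, h j (Finset.mem_range.1 hj), mul_zero]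
    · intro j _
      exact Circle.integrable_of_continuous μ (continuous_const.mul
        (((Complex.continuous_conj.comp continuous_circle_coe).pow j).mul hc))
  have h2 : ∫ z : Circle, ‖Q.eval (z : ℂ)‖ ^ 2 ∂μ = 0 := by
    have : ∀ z : Circle, conj (Q.eval (z : ℂ)) * Q.eval (z : ℂ) =
        ((‖Q.eval (z : ℂ)‖ ^ 2 : ℝ) : ℂ) := fun z => by
      rw [Complex.conj_mul']; push_cast; rfl
    simp_rw [this] at h1
    rw [integral_complex_ofReal] at h1
    exact_mod_cast h1
  have hi : Integrable (fun z : Circle => ‖Q.eval (z : ℂ)‖ ^ 2) μ :=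
    (hc.norm.pow 2).integrable_of_hasCompactSupport (HasCompactSupport.of_compactSpace _)
  rw [integral_eq_zero_iff_of_nonneg (fun z => by positivity) hi] at h2
  have h3 : μ.support ⊆ {z : Circle | Q.eval (z : ℂ) = 0} := by
    refine Measure.support_subset_of_isClosed (isClosed_eq hc continuous_const) ?_
    filter_upwards [h2] with z hz
    simpa using hz
  refine eq_zero_of_infinite_isRoot Q ?_
  refine ((hμ.mono h3).image (f := fun z : Circle => (z : ℂ)) ?_).mono ?_
  · exact fun a _ b _ hab => Circle.ext hab
  · rintro _ ⟨z, hz, rfl⟩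
    exact hz

/-- For a nontrivial probability measure the monic orthogonal polynomials exist and are unique. -/
theorem IsNontrivialMeasure.existsUnique_isMonicOPUC {μ : Measure Circle} [IsProbabilityMeasure μ]
    (hμ : IsNontrivialMeasure μ) (n : ℕ) : ∃! P, IsMonicOPUC μ n P := by
  have hint : ∀ (j : ℕ) (Q : ℂ[X]),
      Integrable (fun z : Circle => conj (z : ℂ) ^ j * Q.eval (z : ℂ)) μ := fun j Q =>
    Circle.integrable_of_continuous μ
      (((Complex.continuous_conj.comp continuous_circle_coe).pow j).mul
        (Q.continuous.comp continuous_circle_coe))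
  let L : degreeLT ℂ n →ₗ[ℂ] (Fin n → ℂ) :=
    { toFun := fun Q j => ∫ z : Circle, conj (z : ℂ) ^ (j : ℕ) * (Q : ℂ[X]).eval (z : ℂ) ∂μ
      map_add' := fun Q R => by
        ext j
        simp only [Submodule.coe_add, eval_add, mul_add, Pi.add_apply]
        exact integral_add (hint _ _) (hint _ _)
      map_smul' := fun a Q => by
        ext j
        simp only [Submodule.coe_smul, eval_smul, smul_eq_mul, Pi.smul_apply, RingHom.id_apply]
        rw [← integral_const_mul]
        congr 1
        ext z
        ring }
  have hL : Function.Injective L := by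
    rw [← LinearMap.ker_eq_bot, LinearMap.ker_eq_bot']
    intro Q hQ
    refine Subtype.ext (hμ.eq_zero_of_orthogonal Q.2 fun j hj => ?_)
    exact congrFun hQ ⟨j, hj⟩
  have : FiniteDimensional ℂ (degreeLT ℂ n) :=
    LinearEquiv.finiteDimensional (degreeLTEquiv ℂ n).symm
  have hS : Function.Surjective L :=
    (LinearMap.injective_iff_surjective_of_finrank_eq_finrank
      (degreeLTEquiv ℂ n).finrank_eq).1 hL
  obtain ⟨Q, hQ⟩ := hS fun j =>
    ∫ z : Circle, conj (z : ℂ) ^ (j : ℕ) * (X ^ n : ℂ[X]).eval (z : ℂ) ∂μ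
  refine ⟨X ^ n - (Q : ℂ[X]), ⟨?_, ?_, fun j hj => ?_⟩, fun P hP => ?_⟩
  · exact monic_X_pow_sub (mem_degreeLT.1 Q.2)
  · refine natDegree_eq_of_degree_eq_some ?_
    rw [degree_sub_eq_left_of_degree_lt, degree_X_pow]
    rw [degree_X_pow]
    exact mem_degreeLT.1 Q.2
  · have := congrFun hQ ⟨j, hj⟩
    simp only [eval_sub, mul_sub]
    rw [integral_sub (hint _ _) (hint _ _), sub_eq_zero]
    exact this.symm
  · have hsub : P - (X ^ n - (Q : ℂ[X])) = 0 := by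
      refine hμ.eq_zero_of_orthogonal (n := n) ?_ fun j hj => ?_
      · have h1 : P - X ^ n ∈ degreeLT ℂ n := by
          rw [mem_degreeLT]
          have hd : P.degree = n := by
            rw [degree_eq_natDegree hP.1.ne_zero, hP.2.1]
          rw [← hd]
          refine degree_sub_lt_left ?_ hP.1.ne_zero ?_
          · rw [hd, degree_X_pow]
          · rw [hP.1.leadingCoeff, (monic_X_pow n).leadingCoeff]
        have h2 := (degreeLT ℂ n).add_mem h1 Q.2
        convert h2 using 1
        ring
      · have := congrFun hQ ⟨j, hj⟩
        simp only [eval_sub, mul_sub]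
        have h4 : Integrable (fun z : Circle => conj (z : ℂ) ^ j * (X ^ n : ℂ[X]).eval (z : ℂ) -
            conj (z : ℂ) ^ j * (Q : ℂ[X]).eval (z : ℂ)) μ := (hint _ _).sub (hint _ _)
        rw [integral_sub (hint _ _) h4, integral_sub (hint _ _) (hint _ _), hP.2.2 j hj, zero_sub, neg_eq_zero, sub_eq_zero]
        exact this.symm
    exact sub_eq_zero.1 hsub

theorem IsNontrivialMeasure.isMonicOPUC_monicOPUC {μ : Measure Circle} [IsProbabilityMeasure μ]
    (hμ : IsNontrivialMeasure μ) (n : ℕ) : IsMonicOPUC μ n (monicOPUC μ n) :=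
  Classical.epsilon_spec (hμ.existsUnique_isMonicOPUC n).exists

theorem IsMinimalParameterSequence.le {d m g : ℕ → ℝ} (hm : IsMinimalParameterSequence d m)
    (hg : IsParameterSequence d g) (n : ℕ) : m n ≤ g n := by
  induction n with
  | zero => rw [hm.2]; exact hg.1.1
  | succ n ih =>
    have h1 := hm.1.2.2 n
    have h2 := hg.2.2 n
    have hg1 : g n < 1 := by
      cases n with
      | zero => exact hg.1.2
      | succ k => exact (hg.2.1 k).2
    have := (hg.2.1 n).1
    by_contra hlt
    nlinarith [(hm.1.2.1 n).1]

/-- Every positive chain sequence has exactly one minimal parameter sequence. -/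
theorem IsPositiveChainSequence.existsUnique_minimal {d : ℕ → ℝ} (hd : IsPositiveChainSequence d) :
    ∃! m, IsMinimalParameterSequence d m := by
  obtain ⟨g, hg⟩ := hd
  have hg1 : ∀ n, g n < 1 := fun n => by
    cases n with
    | zero => exact hg.1.2
    | succ k => exact (hg.2.1 k).2
  have hdpos : ∀ n, 0 < d (n + 1) := fun n => by
    rw [hg.2.2 n]
    exact mul_pos (sub_pos.2 (hg1 n)) (hg.2.1 n).1
  let m : ℕ → ℝ := fun n => Nat.rec 0 (fun k x => d (k + 1) / (1 - x)) n
  have hm0 : m 0 = 0 := rfl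
  have hms : ∀ n, m (n + 1) = d (n + 1) / (1 - m n) := fun n => rfl
  have hle : ∀ n, m n ≤ g n := by
    intro n
    induction n with
    | zero => rw [hm0]; exact hg.1.1
    | succ n ih =>
      have := hg1 n
      rw [hms, div_le_iff₀ (by linarith), hg.2.2 n]
      nlinarith [(hg.2.1 n).1]
  have hlt : ∀ n, m n < 1 := fun n => (hle n).trans_lt (hg1 n)
  have hp : IsMinimalParameterSequence d m := by
    refine ⟨⟨⟨hm0.ge, hlt 0⟩, fun n => ⟨?_, hlt (n + 1)⟩, fun n => ?_⟩, hm0⟩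
    · rw [hms]
      exact div_pos (hdpos n) (sub_pos.2 (hlt n))
    · rw [hms, mul_div_cancel₀ _ (sub_pos.2 (hlt n)).ne']
  exact ⟨m, hp, fun m' hm' =>
    funext fun n => le_antisymm (hm'.le hp.1 n) (hp.le hm'.1 n)⟩

/-! ### Verblunsky coefficients lie in the open unit disc -/

/-! Write `w = τₙ αₙ`. Since `|αₙ| < 1`, every `τₙ` is unimodular, and `w = (b - ic)/(1 - ic)` with
`b = bₙ₊₁`, `c = cₙ₊₁` (`sub_I_mul_div_one_sub_I_mul`). Hence condition 2 says `|αₙ₊ₚ| = |αₙ|`.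
Moreover `(1 + ic)/(1 - ic) = τₙ/τₙ₊₁`, so the sum in condition 1 telescopes to `arg τₙ - arg τₙ₊ₚ`
modulo `2π` (`coe_sum_arg_eq_arg_tauSeq_sub`). The factors `τ` then cancel, and for `αₙ ≠ 0`
condition 1 says `arg αₙ = arg αₙ₊ₚ`.

The analytic input is `|αₙ| < 1`, which holds because the zeros of the orthogonal polynomials lie in
the open disc. -/

theorem IsMonicOPUC.integral_conj_eval_mul {μ : Measure Circle} [IsProbabilityMeasure μ] {n : ℕ}
    {P : ℂ[X]} (hP : IsMonicOPUC μ n P) {q : ℂ[X]} (hq : q.natDegree < n) :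
    ∫ z : Circle, conj (q.eval (z : ℂ)) * P.eval (z : ℂ) ∂μ = 0 := by
  have e : ∀ z : Circle, conj (q.eval (z : ℂ)) * P.eval (z : ℂ) =
      ∑ j ∈ Finset.range n, conj (q.coeff j) * (conj (z : ℂ) ^ j * P.eval (z : ℂ)) := by
    intro z
    rw [eval_eq_sum_range' hq]
    simp only [map_sum, map_mul, map_pow, Finset.sum_mul, mul_assoc]
  simp_rw [e]
  rw [integral_finsetSum]
  · refine Finset.sum_eq_zero fun j hj => ?_
    rw [integral_const_mul, hP.2.2 j (Finset.mem_range.1 hj), mul_zero]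
  · intro j _
    exact Circle.integrable_of_continuous μ (continuous_const.mul
      (((Complex.continuous_conj.comp continuous_circle_coe).pow j).mul
        (P.continuous.comp continuous_circle_coe)))

theorem IsNontrivialMeasure.eq_zero_of_integral_norm_sq {μ : Measure Circle}
    [IsProbabilityMeasure μ] (hμ : IsNontrivialMeasure μ) {Q : ℂ[X]}
    (h : ∫ z : Circle, ‖Q.eval (z : ℂ)‖ ^ 2 ∂μ = 0) : Q = 0 := by
  have hc : Continuous fun z : Circle => Q.eval (z : ℂ) :=
    Q.continuous.comp continuous_circle_coe
  have hi : Integrable (fun z : Circle => ‖Q.eval (z : ℂ)‖ ^ 2) μ :=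
    (hc.norm.pow 2).integrable_of_hasCompactSupport (HasCompactSupport.of_compactSpace _)
  rw [integral_eq_zero_iff_of_nonneg (fun z => by positivity) hi] at h
  refine hμ.eq_zero_of_orthogonal (n := Q.natDegree + 1)
    (mem_degreeLT.2 (degree_le_natDegree.trans_lt (by exact_mod_cast Nat.lt_succ_self _)))
    fun j _ => integral_eq_zero_of_ae ?_
  filter_upwards [h] with z hz
  have : Q.eval (z : ℂ) = 0 := by simpa using hz
  simp [this]

/-- The zeros of the orthogonal polynomials lie in the open unit disc. -/
theorem IsMonicOPUC.norm_lt_one_of_isRoot {μ : Measure Circle} [IsProbabilityMeasure μ]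
    (hμ : IsNontrivialMeasure μ) {n : ℕ} {P : ℂ[X]} (hP : IsMonicOPUC μ n P) {a : ℂ}
    (ha : P.IsRoot a) : ‖a‖ < 1 := by
  obtain ⟨q, rfl⟩ := dvd_iff_isRoot.2 ha
  have hq0 : q ≠ 0 := right_ne_zero_of_mul hP.1.ne_zero
  have hq : q.natDegree < n := by
    have := hP.2.1
    rw [natDegree_mul (X_sub_C_ne_zero a) hq0, natDegree_X_sub_C] at this
    omega
  have horth := hP.integral_conj_eval_mul hq
  by_contra! hge
  have hcq : Continuous fun z : Circle => q.eval (z : ℂ) :=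
    q.continuous.comp continuous_circle_coe
  have hcP : Continuous fun z : Circle => ((X - C a) * q).eval (z : ℂ) :=
    ((X - C a) * q).continuous.comp continuous_circle_coe
  have hre : ∫ z : Circle,
      (conj a * (conj (q.eval (z : ℂ)) * ((X - C a) * q).eval (z : ℂ))).re ∂μ = 0 := by
    have hint : Integrable (fun z : Circle =>
        conj a * (conj (q.eval (z : ℂ)) * ((X - C a) * q).eval (z : ℂ))) μ :=
      Circle.integrable_of_continuous μ (continuous_const.mul
        ((Complex.continuous_conj.comp hcq).mul hcP))
    have h := integral_re hint
    rw [integral_const_mul, horth] at h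
    simpa using h
  -- With `P = (X - a) q`, expand `|zq|² = |P + aq|²` and use `|z| = 1`. The cross term integrates
  -- to zero because `deg q < n`, so `|a| ≥ 1` would force `∫ |P|² ≤ 0`.
  have key : ∀ z : Circle, ‖((X - C a) * q).eval (z : ℂ)‖ ^ 2 =
      (1 - ‖a‖ ^ 2) * ‖q.eval (z : ℂ)‖ ^ 2 -
        2 * (conj a * (conj (q.eval (z : ℂ)) * ((X - C a) * q).eval (z : ℂ))).re := by
    intro z
    have hz : (z : ℂ).re * (z : ℂ).re + (z : ℂ).im * (z : ℂ).im = 1 := by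
      rw [← Complex.normSq_apply, Circle.normSq_coe]
    simp only [eval_mul, eval_sub, eval_X, eval_C, Complex.sq_norm, Complex.normSq_apply,
      Complex.mul_re, Complex.mul_im, Complex.sub_re, Complex.sub_im, Complex.conj_re,
      Complex.conj_im]
    linear_combination ((q.eval (z : ℂ)).re ^ 2 + (q.eval (z : ℂ)).im ^ 2) * hz
  have h0 : ∫ z : Circle, ‖((X - C a) * q).eval (z : ℂ)‖ ^ 2 ∂μ =
      (1 - ‖a‖ ^ 2) * ∫ z : Circle, ‖q.eval (z : ℂ)‖ ^ 2 ∂μ := by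
    simp_rw [key]
    rw [integral_sub, integral_const_mul, integral_const_mul, hre, mul_zero, sub_zero]
    · exact (continuous_const.mul (hcq.norm.pow 2)).integrable_of_hasCompactSupport
        (HasCompactSupport.of_compactSpace _)
    · exact (continuous_const.mul (Complex.continuous_re.comp (continuous_const.mul
        ((Complex.continuous_conj.comp hcq).mul hcP)))).integrable_of_hasCompactSupport
        (HasCompactSupport.of_compactSpace _)
  refine hP.1.ne_zero (hμ.eq_zero_of_integral_norm_sq (le_antisymm ?_ ?_))
  · rw [h0]
    exact mul_nonpos_of_nonpos_of_nonneg (by nlinarith) (integral_nonneg fun z => by positivity)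
  · exact integral_nonneg fun z => by positivity

theorem Multiset.norm_prod_lt_one {s : Multiset ℂ} (hs : s ≠ 0) (h : ∀ z ∈ s, ‖z‖ < 1) :
    ‖s.prod‖ < 1 := by
  induction s using Multiset.induction with
  | empty => exact absurd rfl hs
  | cons a t ih =>
    have ha := h a (Multiset.mem_cons_self a t)
    rw [Multiset.prod_cons, norm_mul]
    rcases eq_or_ne t 0 with rfl | ht
    · simpa using ha
    · exact mul_lt_one_of_nonneg_of_lt_one_left (norm_nonneg a) ha
        (ih ht fun z hz => h z (Multiset.mem_cons_of_mem hz)).le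

/-- Up to sign and conjugation, `αₙ` is the product of the zeros of `φₙ₊₁`; there is at least one,
since the degree is `n + 1`. -/
theorem IsNontrivialMeasure.norm_verblunsky_lt_one {μ : Measure Circle} [IsProbabilityMeasure μ]
    (hμ : IsNontrivialMeasure μ) (n : ℕ) : ‖verblunsky μ n‖ < 1 := by
  have hP := hμ.isMonicOPUC_monicOPUC (n + 1)
  have hsplit : (monicOPUC μ (n + 1)).Splits := IsAlgClosed.splits _
  rw [verblunsky, norm_neg, RCLike.norm_conj,
    hsplit.eval_eq_prod_roots_of_monic hP.1]
  refine Multiset.norm_prod_lt_one ?_ ?_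
  · rw [Ne, Multiset.map_eq_zero, ← Multiset.card_eq_zero, ← hsplit.natDegree_eq_card_roots,
      hP.2.1]
    exact Nat.succ_ne_zero n
  · intro z hz
    obtain ⟨a, ha, rfl⟩ := Multiset.mem_map.1 hz
    rw [zero_sub, norm_neg]
    exact hP.norm_lt_one_of_isRoot hμ (isRoot_of_mem_roots ha)

/-! ### The sequences `τ`, `c`, `m` in terms of `τₙ αₙ` -/

theorem Complex.one_sub_ne_zero_of_norm_lt_one {w : ℂ} (hw : ‖w‖ < 1) : 1 - w ≠ 0 := by
  intro h
  rw [← sub_eq_zero.1 h, norm_one] at hw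
  exact lt_irrefl _ hw

/-- Each step multiplies by a quotient of complex conjugates, which is unimodular. -/
theorem norm_tauSeq {μ : Measure Circle} (hα : ∀ n, ‖verblunsky μ n‖ < 1) (n : ℕ) :
    ‖tauSeq μ n‖ = 1 := by
  induction n with
  | zero => simp [tauSeq]
  | succ n ih =>
    have hw : ‖tauSeq μ n * verblunsky μ n‖ < 1 := by rw [norm_mul, ih, one_mul]; exact hα n
    have h : 1 - conj (tauSeq μ n) * conj (verblunsky μ n) =
        conj (1 - tauSeq μ n * verblunsky μ n) := by simp
    rw [tauSeq, h, norm_mul, norm_div, RCLike.norm_conj, ih, one_mul, div_self]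
    exact norm_ne_zero_iff.2 (Complex.one_sub_ne_zero_of_norm_lt_one hw)

theorem norm_tauSeq_mul_verblunsky_lt_one {μ : Measure Circle}
    (hα : ∀ n, ‖verblunsky μ n‖ < 1) (n : ℕ) : ‖tauSeq μ n * verblunsky μ n‖ < 1 := by
  rw [norm_mul, norm_tauSeq hα, one_mul]
  exact hα n

/-- The upper bound `|1 - w|² < 2(1 - Re w)` is just `|w|² < 1`. -/
theorem mSeq_succ_mem_Ioo {μ : Measure Circle} (hα : ∀ n, ‖verblunsky μ n‖ < 1) (n : ℕ) :
    0 < mSeq μ (n + 1) ∧ mSeq μ (n + 1) < 1 := by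
  have hw := norm_tauSeq_mul_verblunsky_lt_one hα n
  set w := tauSeq μ n * verblunsky μ n with hwdef
  have hre : 0 < 1 - w.re := sub_pos.2 ((Complex.re_le_norm w).trans_lt hw)
  have hpos : 0 < ‖1 - w‖ := norm_pos_iff.2 (Complex.one_sub_ne_zero_of_norm_lt_one hw)
  have hsq : w.re * w.re + w.im * w.im < 1 := by
    rw [← Complex.normSq_apply, ← Complex.sq_norm]
    nlinarith [norm_nonneg w]
  rw [mSeq, ← hwdef]
  refine ⟨by positivity, ?_⟩
  rw [← mul_div_assoc, div_lt_one hre, Complex.sq_norm, Complex.normSq_apply]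
  simp only [Complex.sub_re, Complex.sub_im, Complex.one_re, Complex.one_im]
  nlinarith

/-- Both are parameter sequences of `d` starting at `0`, and such a sequence is unique. -/
theorem IsAssociatedMeasure.eq_mSeq {μ : Measure Circle} {c d m : ℕ → ℝ}
    (hμ : IsAssociatedMeasure μ c d) (hα : ∀ n, ‖verblunsky μ n‖ < 1)
    (hm : IsMinimalParameterSequence d m) : m = mSeq μ :=
  (show IsPositiveChainSequence d from ⟨m, hm.1⟩).existsUnique_minimal.unique hm
    ⟨⟨by simp [mSeq], mSeq_succ_mem_Ioo hα, hμ.d_eq⟩, rfl⟩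

theorem one_sub_I_mul_ne_zero (x : ℝ) : (1 : ℂ) - Complex.I * x ≠ 0 := by
  intro h
  simpa using congrArg Complex.re h

/-- Recovering `w` from `c = -Im w / (1 - Re w)` and `b = 1 - |1 - w|² / (1 - Re w)`. -/
theorem sub_I_mul_div_one_sub_I_mul {w : ℂ} {b c : ℝ} (hw : ‖w‖ < 1)
    (hc : c = -w.im / (1 - w.re)) (hb : b = 1 - 2 * (1 / 2 * (‖1 - w‖ ^ 2 / (1 - w.re)))) :
    ((b : ℂ) - Complex.I * c) / (1 - Complex.I * c) = w := by
  have hre : 1 - w.re ≠ 0 := (sub_pos.2 ((Complex.re_le_norm w).trans_lt hw)).ne'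
  rw [Complex.sq_norm, Complex.normSq_apply] at hb
  simp only [Complex.sub_re, Complex.sub_im, Complex.one_re, Complex.one_im] at hb
  -- After multiplication by `1 - Re w`, the denominator becomes `1 - conj w` and the numerator `(1
  -- - conj w) - |1 - w|² = (1 - conj w) w`.
  rw [div_eq_iff (one_sub_I_mul_ne_zero c)]
  apply Complex.ext <;> simp <;> rw [hc]
  · rw [hb]
    field_simp
    ring
  · field_simp
    ring

/-- By the choice of `c`, `1 - w = (1 - Re w)(1 + ic)`; the real factor cancels against that of the
conjugate. -/
theorem one_add_I_mul_div_one_sub_I_mul {w : ℂ} {c : ℝ} (hw : ‖w‖ < 1)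
    (hc : c = -w.im / (1 - w.re)) :
    (1 + Complex.I * c) / (1 - Complex.I * c) = (1 - w) / (1 - conj w) := by
  have hre : 1 - w.re ≠ 0 := (sub_pos.2 ((Complex.re_le_norm w).trans_lt hw)).ne'
  rw [div_eq_div_iff (one_sub_I_mul_ne_zero c)
    (Complex.one_sub_ne_zero_of_norm_lt_one (by rwa [RCLike.norm_conj]))]
  apply Complex.ext <;> simp <;> rw [hc] <;> field_simp

theorem norm_sub_I_mul_div_one_sub_I_mul_sq (b c : ℝ) :
    ‖((b : ℂ) - Complex.I * c) / (1 - Complex.I * c)‖ ^ 2 = (b ^ 2 + c ^ 2) / (1 + c ^ 2) := by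
  rw [norm_div, div_pow, Complex.sq_norm, Complex.sq_norm, Complex.normSq_apply,
    Complex.normSq_apply]
  simp [sq]

theorem sub_I_mul_div_one_sub_I_mul_ne_zero_iff (b c : ℝ) :
    ((b : ℂ) - Complex.I * c) / (1 - Complex.I * c) ≠ 0 ↔ b ≠ 0 ∨ c ≠ 0 := by
  rw [← not_and_or, not_iff_not, div_eq_zero_iff, or_iff_left (one_sub_I_mul_ne_zero c),
    Complex.ext_iff]
  simp

/-- The arguments of `(1 + i cⱼ) / (1 - i cⱼ)` telescope to the angle between `τₙ` and `τₙ₊ₚ`. -/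
theorem coe_sum_arg_eq_arg_tauSeq_sub {μ : Measure Circle} {c : ℕ → ℝ}
    (hα : ∀ n, ‖verblunsky μ n‖ < 1) (hc : ∀ n, c (n + 1) = cSeq μ (n + 1)) (n p : ℕ) :
    ((∑ j ∈ Finset.Icc (n + 1) (n + p),
      Complex.arg ((1 + Complex.I * c j) / (1 - Complex.I * c j)) : ℝ) : Real.Angle) =
      (tauSeq μ n).arg - (tauSeq μ (n + p)).arg := by
  induction p with
  | zero => simp
  | succ p ih =>
    have hτ : ∀ k, tauSeq μ k ≠ 0 := fun k => norm_ne_zero_iff.1 (by simp [norm_tauSeq hα k])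
    have hw := norm_tauSeq_mul_verblunsky_lt_one hα (n + p)
    have h1 := Complex.one_sub_ne_zero_of_norm_lt_one hw
    have h2 : 1 - conj (tauSeq μ (n + p) * verblunsky μ (n + p)) ≠ 0 :=
      Complex.one_sub_ne_zero_of_norm_lt_one (by rwa [RCLike.norm_conj])
    have hstep : tauSeq μ (n + p) / tauSeq μ (n + p + 1) =
        (1 - tauSeq μ (n + p) * verblunsky μ (n + p)) /
          (1 - conj (tauSeq μ (n + p) * verblunsky μ (n + p))) := by
      rw [div_eq_div_iff (hτ _) h2, tauSeq, ← map_mul]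
      field_simp
    rw [← add_assoc, Finset.sum_Icc_succ_top (by omega), Real.Angle.coe_add, ih,
      one_add_I_mul_div_one_sub_I_mul hw (hc (n + p)), ← hstep,
      Complex.arg_div_coe_angle (hτ _) (hτ _)]
    abel

theorem mainTheorem5 (μ : Measure Circle) (c d m b : ℕ → ℝ)
    (hd : IsPositiveChainSequence d)
    (hμ : IsAssociatedMeasure μ c d)
    (hm : IsMinimalParameterSequence d m)
    (hb : ∀ n, 1 ≤ n → b n = 1 - 2 * m n)
    (p : ℕ) (hp : 1 ≤ p) :
    Function.Periodic (verblunsky μ) p ↔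
      ∀ n : ℕ,
        ((b (n + 1) ≠ 0 ∨ c (n + 1) ≠ 0) →
          ∃ k : ℤ,
            ∑ j ∈ Finset.Icc (n + 1) (n + p),
                Complex.arg ((1 + Complex.I * c j) / (1 - Complex.I * c j)) =
              Complex.arg ((b (n + 1) - Complex.I * c (n + 1)) / (1 - Complex.I * c (n + 1))) -
                Complex.arg ((b (n + p + 1) - Complex.I * c (n + p + 1)) /
                  (1 - Complex.I * c (n + p + 1))) +
                2 * k * Real.pi) ∧
        (b (n + 1) ^ 2 + c (n + 1) ^ 2) / (1 + c (n + 1) ^ 2) =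
          (b (n + p + 1) ^ 2 + c (n + p + 1) ^ 2) / (1 + c (n + p + 1) ^ 2) := by
  have := hμ.isProbabilityMeasure
  have hα := hμ.isNontrivial.norm_verblunsky_lt_one
  have hτ : ∀ k, tauSeq μ k ≠ 0 := fun k => norm_ne_zero_iff.1 (by simp [norm_tauSeq hα k])
  have hw : ∀ n, ((b (n + 1) : ℂ) - Complex.I * c (n + 1)) / (1 - Complex.I * c (n + 1)) =
      tauSeq μ n * verblunsky μ n := fun n =>
    sub_I_mul_div_one_sub_I_mul (norm_tauSeq_mul_verblunsky_lt_one hα n) (hμ.c_eq n)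
      (by rw [hb (n + 1) (Nat.le_add_left 1 n), hμ.eq_mSeq hα hm, mSeq])
  -- The equivalence already holds for each `n` separately.
  refine forall_congr' fun n => ?_
  rw [← sub_I_mul_div_one_sub_I_mul_ne_zero_iff, ← norm_sub_I_mul_div_one_sub_I_mul_sq,
    ← norm_sub_I_mul_div_one_sub_I_mul_sq, hw n, hw (n + p), sq_eq_sq₀ (norm_nonneg _)
    (norm_nonneg _), norm_mul, norm_mul, norm_tauSeq hα, norm_tauSeq hα, one_mul, one_mul,
    mul_ne_zero_iff, and_iff_right (hτ n)]
  -- If `αₙ = 0`, condition 1 is vacuous and the equality of norms alone gives `αₙ₊ₚ = 0`.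
  rcases eq_or_ne (verblunsky μ n) 0 with h0 | h0
  · simp [h0, eq_comm]
  have harg : verblunsky μ (n + p) ≠ 0 →
      ((∃ k : ℤ, ∑ j ∈ Finset.Icc (n + 1) (n + p),
          Complex.arg ((1 + Complex.I * c j) / (1 - Complex.I * c j)) =
        (tauSeq μ n * verblunsky μ n).arg - (tauSeq μ (n + p) * verblunsky μ (n + p)).arg +
          2 * k * Real.pi) ↔ (verblunsky μ n).arg = (verblunsky μ (n + p)).arg) := by
    intro h1
    have hk : ∀ (x y : ℝ), (∃ k : ℤ, x = y + 2 * k * Real.pi) ↔ (x : Real.Angle) = y := by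
      intro x y
      rw [Real.Angle.angle_eq_iff_two_pi_dvd_sub]
      refine exists_congr fun k => ⟨fun h => ?_, fun h => ?_⟩ <;> linarith
    -- Modulo `2π` arguments are additive on nonzero factors, so the `τ` terms cancel; principal
    -- arguments congruent modulo `2π` are equal.
    rw [hk, coe_sum_arg_eq_arg_tauSeq_sub hα hμ.c_eq, Real.Angle.coe_sub,
      Complex.arg_mul_coe_angle (hτ _) h0, Complex.arg_mul_coe_angle (hτ _) h1,
      add_sub_add_comm, left_eq_add, sub_eq_zero, Complex.arg_coe_angle_eq_iff]
  constructor
  · intro h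
    exact ⟨fun _ => (harg (by rwa [h])).2 (by rw [h]), by rw [h]⟩
  · rintro ⟨h1, h2⟩
    have hne : verblunsky μ (n + p) ≠ 0 := by
      rw [← norm_ne_zero_iff, ← h2]
      exact norm_ne_zero_iff.2 h0
    exact (Complex.ext_norm_arg h2 ((harg hne).1 (h1 h0))).symm
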